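/- Let $I$ be a finite set and let $\mathcal F=\big(\{M_i\}_{i\in I},\{M_{ij}\}_{i,j\in I},\{f_{ij}\}_{i,j\in I}\big)$ be a smooth adjunction system: the $M_i$ are smooth, Hausdorff, second-countable manifolds (without boundary) of the same dimension $d$, each $M_{ij}\subseteq M_i$ is open, each $f_{ij}\colon M_{ij}\to M_j$ is smooth, and for all $i,j,k\in I$ (1) $M_{ii}=M_i$ and $f_{ii}=\mathrm{id}_{M_i}$; (2) $f_{ij}(M_{ij})=M_{ji}$ and $f_{ij}^{-1}=f_{ji}$; (3) if $x\in M_{ij}\cap M_{ik}$, then $f_{ij}(x)\in M_{jk}$ and $f_{ik}(x)=f_{jk}(f_{ij}(x))$. Let $\mathbf M=\big(\bigsqcup_{i\in I} M_i\big)/\!\sim$, where $(x,i)\sim(y,j)$ if and only if $x\in M_{ij}$ and $f_{ij}(x)=y$, be the resulting (in general non-Hausdorff) smooth manifold, with canonical open embeddings $\phi_i\colon M_i\to\mathbf M$, $\phi_i(x)=[x,i]$, and with the smooth structure given by the charts $\alpha\circ\phi_i^{-1}$ for $\alpha$ a chart of $M_i$. Let $\mathbf E\to\mathbf M$ be any smooth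 real vector bundle of finite rank. Let $E_i:=\phi_i^*\mathbf E$ be its restriction to $M_i$, and let $F_{ij}\colon E_i|_{M_{ij}}\to E_j$, $(x,v)\mapsto(f_{ij}(x),v)$, be the induced gluing morphisms, which cover $f_{ij}$. Writing $\Gamma$ for the real vector space of smooth sections, put $$\prod_{\mathcal F}\Gamma(E_i):=\Big\{(s_i)_{i\in I}\in\prod_{i\in I}\Gamma(E_i)\ \Big|\ F_{ij}\circ s_i=s_j\circ f_{ij}\ \text{ on } M_{ij}\text{ for all } i,j\in I\Big\}.$$ Then restriction of sections, $\mathbf s\mapsto(\phi_i^*\mathbf s)_{i\in I}$, where $(\phi_i^*\mathbf s)(x)=\mathbf s(\phi_i(x))$, is an isomorphism of real vector spaces $$\Gamma(\mathbf E)\;\cong\;\prod_{\mathcal F}\Gamma(E_i).$$ -/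

import Mathlib

open Set Bundle TopologicalSpace Topology
open scoped Manifold ContDiff Bundle

universe u v

/-- A smooth adjunction system `(M, A, f)` of `d`-dimensional smooth manifolds `M i`: open gluing
regions `A i j ⊆ M i` and smooth gluing maps `f i j : A i j → M j` subject to the consistency
conditions that make "`f i j x = y`" an equivalence relation on the disjoint union of the `M i`.
(By `f_range` and `f_symm`, each `f i j` is a diffeomorphism of `A i j` onto `A j i`, in particular
an open embedding into `M j`.) -/
structure SmoothAdjunctionSystem (d : ℕ) {I : Type u} (M : I → Type v)
    [∀ i, TopologicalSpace (M i)] [∀ i, ChartedSpace (EuclideanSpace ℝ (Fin d)) (M i)] where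
  /-- the gluing region `M_{ij} ⊆ M_i` -/
  A : ∀ i _j : I, Opens (M i)
  /-- the gluing map `f_{ij} : M_{ij} → M_j` -/
  f : ∀ i j : I, A i j → M j
  smooth_f : ∀ i j, ContMDiff (𝓡 d) (𝓡 d) ∞ (f i j)
  A_self : ∀ i, A i i = ⊤
  f_self : ∀ i (x : A i i), f i i x = x
  f_range : ∀ i j, Set.range (f i j) = (A j i : Set (M j))
  f_symm : ∀ i j (x : A i j) (y : A j i), f i j x = y → f j i y = x
  f_trans : ∀ i j k (x : M i) (hj : x ∈ A i j) (hk : x ∈ A i k),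
    ∃ h : f i j ⟨x, hj⟩ ∈ A j k, f i k ⟨x, hk⟩ = f j k ⟨f i j ⟨x, hj⟩, h⟩

namespace SmoothAdjunctionSystem

section Topology

variable {d : ℕ} {I : Type u} {M : I → Type v}
  [∀ i, TopologicalSpace (M i)] [∀ i, ChartedSpace (EuclideanSpace ℝ (Fin d)) (M i)]
  (D : SmoothAdjunctionSystem d M)

theorem f_mem (i j : I) (x : D.A i j) : D.f i j x ∈ D.A j i := by
  have h : D.f i j x ∈ Set.range (D.f i j) := ⟨x, rfl⟩
  rw [D.f_range] at h
  exact h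

theorem f_f (i j : I) (x : D.A i j) : D.f j i ⟨D.f i j x, D.f_mem i j x⟩ = x :=
  D.f_symm i j x ⟨_, D.f_mem i j x⟩ rfl

/-- The relation on the disjoint union identifying `(x, i)` with `(y, j)` when `f_{ij}(x) = y`. -/
def Rel (p q : Σ i, M i) : Prop :=
  ∃ h : p.2 ∈ D.A p.1 q.1, D.f p.1 q.1 ⟨p.2, h⟩ = q.2

theorem rel_equivalence : Equivalence D.Rel where
  refl := by
    rintro ⟨i, x⟩
    exact ⟨by rw [D.A_self]; trivial, D.f_self i _⟩
  symm := by
    rintro ⟨i, x⟩ ⟨j, y⟩ ⟨h, hy⟩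
    dsimp only at h hy
    subst hy
    exact ⟨D.f_mem i j ⟨x, h⟩, D.f_f i j ⟨x, h⟩⟩
  trans := by
    rintro ⟨i, x⟩ ⟨j, y⟩ ⟨k, z⟩ ⟨h, hy⟩ ⟨h', hz⟩
    dsimp only at h hy h' hz
    subst hy
    have hf := D.f_f i j ⟨x, h⟩
    obtain ⟨h₁, h₂⟩ := D.f_trans j i k _ (D.f_mem i j ⟨x, h⟩) h'
    refine ⟨by rw [hf] at h₁; exact h₁, ?_⟩
    dsimp only
    rw [← hz, h₂]
    congr 1
    exact Subtype.ext hf.symm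

/-- The setoid of the gluing relation. -/
def setoid : Setoid (Σ i, M i) := ⟨D.Rel, D.rel_equivalence⟩

/-- The adjunction space subordinate to the system: the quotient of the disjoint union of the `M i`
by the gluing relation. It need not be Hausdorff. -/
def Space : Type (max u v) := Quotient D.setoid

/-- The adjunction space carries the quotient topology. -/
instance : TopologicalSpace D.Space :=
  inferInstanceAs (TopologicalSpace (Quotient D.setoid))

/-- The underlying function `x ↦ [x, i]` of the canonical embedding `φ_i`. -/
def incl (i : I) (x : M i) : D.Space := Quotient.mk D.setoid ⟨i, x⟩

theorem incl_eq_incl {i j : I} {x : M i} {y : M j} :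
    D.incl i x = D.incl j y ↔ ∃ h : x ∈ D.A i j, D.f i j ⟨x, h⟩ = y :=
  Quotient.eq (r := D.setoid)

theorem incl_f (i j : I) (x : D.A i j) : D.incl i (x : M i) = D.incl j (D.f i j x) :=
  D.incl_eq_incl.2 ⟨x.2, rfl⟩

theorem continuous_incl (i : I) : Continuous (D.incl i) :=
  continuous_quot_mk.comp continuous_sigmaMk

theorem isOpenEmbedding_incl (i : I) : IsOpenEmbedding (D.incl i) := by
  refine .of_continuous_injective_isOpenMap (D.continuous_incl i) ?_ ?_
  · intro x y hxy
    obtain ⟨h, h'⟩ := D.incl_eq_incl.1 hxy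
    rw [← h', D.f_self]
  · intro U hU
    refine isOpen_coinduced.2 (isOpen_sigma_iff.2 fun j => ?_)
    have : (Sigma.mk j ⁻¹' (Quotient.mk D.setoid ⁻¹' (D.incl i '' U)) : Set (M j)) =
        Subtype.val '' (D.f j i ⁻¹' U) := by
      ext y
      constructor
      · rintro ⟨x, hx, hxy⟩
        obtain ⟨h, h'⟩ := D.incl_eq_incl.1 (hxy.symm : D.incl j y = D.incl i x)
        exact ⟨⟨y, h⟩, by rw [mem_preimage, h']; exact hx, rfl⟩
      · rintro ⟨y, hy, rfl⟩
        exact ⟨D.f j i y, hy, (D.incl_f j i y).symm⟩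
    erw [this]
    exact (D.A j i).isOpen.isOpenMap_subtype_val _
      (hU.preimage (D.smooth_f j i).continuous)

theorem exists_rep (p : D.Space) : ∃ q : Σ i, M i, D.incl q.1 q.2 = p :=
  Quotient.exists_rep p

/-- The atlas of the adjunction space: the charts `α ∘ φ_i⁻¹` on `φ_i(U)`, where `(U, α)` is a chart
of `M i`. -/
noncomputable instance : ChartedSpace (EuclideanSpace ℝ (Fin d)) D.Space where
  atlas := {e | ∃ i, ∃ α ∈ atlas (EuclideanSpace ℝ (Fin d)) (M i),
    e = α.lift_openEmbedding (D.isOpenEmbedding_incl i)}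
  chartAt p := (chartAt (EuclideanSpace ℝ (Fin d)) (D.exists_rep p).choose.2).lift_openEmbedding
    (D.isOpenEmbedding_incl (D.exists_rep p).choose.1)
  mem_chart_source p :=
    ⟨(D.exists_rep p).choose.2, mem_chart_source _ _, (D.exists_rep p).choose_spec⟩
  chart_mem_atlas _ := ⟨_, _, chart_mem_atlas _ _, rfl⟩

theorem mem_atlas_iff {e : OpenPartialHomeomorph D.Space (EuclideanSpace ℝ (Fin d))} :
    e ∈ atlas (EuclideanSpace ℝ (Fin d)) D.Space ↔
      ∃ i, ∃ α ∈ atlas (EuclideanSpace ℝ (Fin d)) (M i),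
        e = α.lift_openEmbedding (D.isOpenEmbedding_incl i) := Iff.rfl

end Topology

section Smooth

variable {d : ℕ} {I : Type u} {M : I → Type v}
  [∀ i, TopologicalSpace (M i)] [∀ i, ChartedSpace (EuclideanSpace ℝ (Fin d)) (M i)]
  [∀ i, IsManifold (𝓡 d) ∞ (M i)] (D : SmoothAdjunctionSystem d M)

/-- The adjunction space is a smooth (possibly non-Hausdorff) manifold. -/
instance : IsManifold (𝓡 d) ∞ D.Space := by
  refine isManifold_of_contDiffOn _ _ _ fun e e' he he' => ?_
  obtain ⟨i, α, hα, rfl⟩ := D.mem_atlas_iff.1 he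
  obtain ⟨j, β, hβ, rfl⟩ := D.mem_atlas_iff.1 he'
  rw [← contMDiffOn_iff_contDiffOn]
  simp only [modelWithCornersSelf_coe, modelWithCornersSelf_coe_symm, preimage_id, range_id,
    inter_univ, Function.id_comp, Function.comp_id]
  rintro z ⟨hz, y, hy, hyz⟩
  have hzα : z ∈ α.target := hz
  obtain ⟨h, h'⟩ := D.incl_eq_incl.1 (hyz.symm : D.incl i (α.symm z) = D.incl j y)
  have hA : α.target ∩ α.symm ⁻¹' (D.A i j) ∈ 𝓝 z :=
    (α.isOpen_inter_preimage_symm (D.A i j).isOpen).mem_nhds ⟨hzα, h⟩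
  classical
  let g : M i → M j := fun x => if hx : x ∈ D.A i j then D.f i j ⟨x, hx⟩ else y
  have hgf : (fun x : D.A i j => g x) = D.f i j := by
    funext x
    exact dif_pos x.2
  have hg : ContMDiffAt (𝓡 d) (𝓡 d) ∞ g (α.symm z) := by
    have := D.smooth_f i j ⟨_, h⟩
    rw [← hgf] at this
    exact contMDiffAt_subtype_iff.1 this
  have hgz : g (α.symm z) = y := by rw [← h']; exact dif_pos h
  have h₁ : ContMDiffAt (𝓡 d) (𝓡 d) ∞ α.symm z :=
    contMDiffAt_symm_of_mem_maximalAtlas (IsManifold.subset_maximalAtlas hα) hzα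
  have h₂ : ContMDiffAt (𝓡 d) (𝓡 d) ∞ β (g (α.symm z)) := by
    rw [hgz]
    exact contMDiffAt_of_mem_maximalAtlas (IsManifold.subset_maximalAtlas hβ) hy
  have h₃ : ContMDiffAt (𝓡 d) (𝓡 d) ∞ (β ∘ g ∘ α.symm) z := h₂.comp z (hg.comp z h₁)
  refine (h₃.congr_of_eventuallyEq ?_).contMDiffWithinAt
  filter_upwards [hA] with w hw
  have hgw : g (α.symm w) = D.f i j ⟨α.symm w, hw.2⟩ := dif_pos hw.2
  change (β.lift_openEmbedding (D.isOpenEmbedding_incl j)) (D.incl i (α.symm w)) =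
    β (g (α.symm w))
  rw [hgw, D.incl_f i j ⟨α.symm w, hw.2⟩, OpenPartialHomeomorph.lift_openEmbedding_apply]

theorem contMDiff_incl (i : I) : ContMDiff (𝓡 d) (𝓡 d) ∞ (D.incl i) := by
  intro x
  let α := chartAt (EuclideanSpace ℝ (Fin d)) x
  let e := α.lift_openEmbedding (D.isOpenEmbedding_incl i)
  have he : e ∈ IsManifold.maximalAtlas (𝓡 d) ∞ D.Space :=
    IsManifold.subset_maximalAtlas (D.mem_atlas_iff.2 ⟨i, α, chart_mem_atlas _ _, rfl⟩)
  have h₁ : ContMDiffAt (𝓡 d) (𝓡 d) ∞ α x :=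
    contMDiffAt_of_mem_maximalAtlas (IsManifold.chart_mem_maximalAtlas x) (mem_chart_source _ x)
  have h₂ : ContMDiffAt (𝓡 d) (𝓡 d) ∞ e.symm (α x) :=
    contMDiffAt_symm_of_mem_maximalAtlas he (α.map_source (mem_chart_source _ x))
  refine (h₂.comp x h₁).congr_of_eventuallyEq ?_
  filter_upwards [α.open_source.mem_nhds (mem_chart_source _ x)] with w hw
  change D.incl i w = D.incl i (α.symm (α w))
  rw [α.left_inv hw]

/-- The canonical embedding `φ_i : M_i → M`, as a smooth map. -/
noncomputable def φ (i : I) : C^∞⟮𝓡 d, M i; 𝓡 d, D.Space⟯ := ⟨D.incl i, D.contMDiff_incl i⟩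

theorem φ_f (i j : I) (x : D.A i j) : D.φ i (x : M i) = D.φ j (D.f i j x) := D.incl_f i j x

end Smooth

section Sections

variable {d : ℕ} {I : Type u} {M : I → Type v}
  [∀ i, TopologicalSpace (M i)] [∀ i, ChartedSpace (EuclideanSpace ℝ (Fin d)) (M i)]
  [∀ i, IsManifold (𝓡 d) ∞ (M i)] (D : SmoothAdjunctionSystem d M)
  (F : Type*) [NormedAddCommGroup F] [NormedSpace ℝ F]
  (E : D.Space → Type*) [TopologicalSpace (TotalSpace F E)]
  [∀ p, AddCommGroup (E p)] [∀ p, Module ℝ (E p)] [∀ p, TopologicalSpace (E p)]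
  [FiberBundle F E] [VectorBundle ℝ F E]

/-- The restricted bundle `E_i = φ_i^* E` over `M_i`. -/
abbrev restr (i : I) : M i → Type _ := D.φ i *ᵖ E

/-- The additive group structure on the fibre of `E_i` over `x`, namely that of the fibre of `E` over
`[x, i]`. -/
noncomputable instance restrAddCommGroup (E : D.Space → Type*) [∀ p, AddCommGroup (E p)]
    (i : I) (x : M i) : AddCommGroup (D.restr E i x) :=
  inferInstanceAs (AddCommGroup (E (D.φ i x)))

/-- The restriction `E_{ij}` of `E_i` to the gluing region `M_{ij}`. -/
abbrev restrOverlap (i j : I) : D.A i j → Type _ :=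
  (Subtype.val : D.A i j → M i) *ᵖ (D.restr E i)

/-- The identity of the fibre of `E` over `[x, i] = [f_{ij}(x), j]`, as an isomorphism from the
fibre of `E_i` over `x` to the fibre of `E_j` over `f_{ij}(x)`. -/
noncomputable def fibreEquiv (i j : I) (x : D.A i j) : D.restrOverlap E i j x ≃ₗ[ℝ] D.restr E j (D.f i j x) :=
  LinearEquiv.cast (R := ℝ) (M := E) (D.φ_f i j x)

/-- The gluing morphism `F_{ij} : E_{ij} → E_j`, `(x, v) ↦ (f_{ij}(x), v)`, covering `f_{ij}`. -/
noncomputable def bundleMap (i j : I) :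
    TotalSpace F (D.restrOverlap E i j) → TotalSpace F (D.restr E j) :=
  fun p => ⟨D.f i j p.1, D.fibreEquiv E i j p.1 p.2⟩

/-- The fibred product of the spaces `Γ(E_i)` of smooth sections: the tuples `(s_i)` with
`F_{ij} ∘ s_i = s_j ∘ f_{ij}` on `M_{ij}` for all `i, j`. -/
noncomputable def fibredProduct : Submodule ℝ (∀ i, Cₛ^∞⟮𝓡 d; F, D.restr E i⟯) where
  carrier := {s | ∀ (i j : I) (x : D.A i j),
    D.bundleMap F E i j ⟨x, s i x⟩ = ⟨D.f i j x, s j (D.f i j x)⟩}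
  add_mem' := by
    intro s t hs ht i j x
    have h₁ := TotalSpace.mk_inj.1 (hs i j x)
    have h₂ := TotalSpace.mk_inj.1 (ht i j x)
    refine TotalSpace.mk_inj.2 ?_
    exact (map_add (D.fibreEquiv E i j x) (s i x) (t i x)).trans (congrArg₂ (· + ·) h₁ h₂)
  zero_mem' := by
    intro i j x
    refine TotalSpace.mk_inj.2 ?_
    exact map_zero (D.fibreEquiv E i j x)
  smul_mem' := by
    intro c s hs i j x
    have h₁ := TotalSpace.mk_inj.1 (hs i j x)
    refine TotalSpace.mk_inj.2 ?_
    exact (map_smul (D.fibreEquiv E i j x) c (s i x)).trans (congrArg (c • ·) h₁)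

end Sections

end SmoothAdjunctionSystem

/-! Sections of a bundle form a sheaf, and the images of the `φ i` are an open cover of the
adjunction space. A section is therefore determined by its restrictions, and restrictions
automatically agree under the gluing morphisms, which only transport vectors along equalities `φ i x
= φ j (f i j x)`. Conversely, a compatible family has one value at each point, whichever
representative is used (`cast_fibredProduct`), so it defines a section `glue`. Its smoothness is a
local question and can be tested after pulling back along each `φ i`
(`contMDiffAt_section_incl_iff`), where the given smooth sections reappear. No partition of unity
enters, so points that cannot be separated cause no trouble. -/

namespace SmoothAdjunctionSystem

section

variable {d : ℕ} {I : Type u} {M : I → Type v}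
  [∀ i, TopologicalSpace (M i)] [∀ i, ChartedSpace (EuclideanSpace ℝ (Fin d)) (M i)]
  [∀ i, IsManifold (𝓡 d) ∞ (M i)] (D : SmoothAdjunctionSystem d M)

/-- Since `φ_i` is an open embedding onto which charts are transported, a map out of the adjunction
space is smooth at `φ_i x` as soon as its composite with `φ_i` is smooth at `x`. -/
theorem contMDiffAt_of_comp_incl {F : Type*} [NormedAddCommGroup F] [NormedSpace ℝ F]
    {g : D.Space → F} {i : I} {x : M i}
    (h : ContMDiffAt (𝓡 d) 𝓘(ℝ, F) ∞ (fun y => g (D.incl i y)) x) :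
    ContMDiffAt (𝓡 d) 𝓘(ℝ, F) ∞ g (D.incl i x) := by
  let α := chartAt (EuclideanSpace ℝ (Fin d)) x
  let e := α.lift_openEmbedding (D.isOpenEmbedding_incl i)
  have he : e ∈ IsManifold.maximalAtlas (𝓡 d) ∞ D.Space :=
    IsManifold.subset_maximalAtlas (D.mem_atlas_iff.2 ⟨i, α, chart_mem_atlas _ _, rfl⟩)
  have hx : x ∈ α.source := mem_chart_source _ x
  have hxe : D.incl i x ∈ e.source := ⟨x, hx, rfl⟩
  have hex : e (D.incl i x) = α x :=
    OpenPartialHomeomorph.lift_openEmbedding_apply _ _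
  have h₁ : ContMDiffAt (𝓡 d) (𝓡 d) ∞ e (D.incl i x) := contMDiffAt_of_mem_maximalAtlas he hxe
  have h₂ : ContMDiffAt (𝓡 d) (𝓡 d) ∞ α.symm (e (D.incl i x)) := by
    rw [hex]
    exact contMDiffAt_symm_of_mem_maximalAtlas (IsManifold.chart_mem_maximalAtlas x)
      (α.map_source hx)
  have h₃ : ContMDiffAt (𝓡 d) 𝓘(ℝ, F) ∞ (fun y => g (D.incl i y))
      (α.symm (e (D.incl i x))) := by
    rw [hex, α.left_inv hx]
    exact h
  -- Since `e` is `α` transported by `incl i`, the map `α.symm ∘ e` is a smooth local inverse of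
  -- `incl i`; composing with it recovers `g`.
  refine (h₃.comp (D.incl i x) (h₂.comp (D.incl i x) h₁)).congr_of_eventuallyEq ?_
  filter_upwards [e.open_source.mem_nhds hxe] with p hp
  exact congrArg g (e.left_inv hp).symm

variable (F : Type*) [NormedAddCommGroup F] [NormedSpace ℝ F]
  (E : D.Space → Type*) [TopologicalSpace (TotalSpace F E)]
  [∀ p, AddCommGroup (E p)] [∀ p, Module ℝ (E p)] [∀ p, TopologicalSpace (E p)]
  [FiberBundle F E] [VectorBundle ℝ F E]

omit [∀ p, Module ℝ (E p)] [VectorBundle ℝ F E] in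
/-- A section of `E` is smooth at `φ_i x` iff its restriction to `M_i` is smooth at `x`. -/
theorem contMDiffAt_section_incl_iff (s : ∀ p, E p) (i : I) (x : M i) :
    ContMDiffAt (𝓡 d) ((𝓡 d).prod 𝓘(ℝ, F)) ∞ (fun p => TotalSpace.mk' F p (s p)) (D.φ i x) ↔
      ContMDiffAt (𝓡 d) ((𝓡 d).prod 𝓘(ℝ, F)) ∞
        (fun y => TotalSpace.mk' F (E := D.restr E i) y (s (D.φ i y))) x := by
  have h₁ := contMDiffAt_section (IB := 𝓡 d) (n := ∞) (F := F) (E := E) (s := s) (D.φ i x)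
  have h₂ := contMDiffAt_section (IB := 𝓡 d) (n := ∞) (F := F) (E := D.restr E i)
    (s := fun y => s (D.φ i y)) x
  refine h₁.trans (Iff.trans ?_ h₂.symm)
  -- The preferred trivialization of the pullback at `x` is the pullback of the one at `φ i x`, so
  -- the fibre coordinate of the restricted section is that of `s` composed with `incl i`.
  exact ⟨fun h => h.comp x (D.contMDiff_incl i x), fun h => D.contMDiffAt_of_comp_incl h⟩

/-- The restrictions `φ_i^* s` of a smooth section of `E`. -/
noncomputable def restrict (s : Cₛ^∞⟮𝓡 d; F, E⟯) (i : I) : Cₛ^∞⟮𝓡 d; F, D.restr E i⟯ :=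
  ⟨fun x => s (D.φ i x), fun x =>
    (D.contMDiffAt_section_incl_iff F E s i x).1 (s.contMDiff (D.φ i x))⟩

-- Dependent functions commute with transport. As `fibreEquiv` is such a transport, this is the
-- compatibility of the restrictions of a global section.
omit [∀ i, IsManifold (𝓡 d) ∞ (M i)] [∀ p, TopologicalSpace (E p)] in
theorem cast_section (s : ∀ p, E p) {p q : D.Space} (h : p = q) :
    LinearEquiv.cast (R := ℝ) (M := E) h (s p) = s q := by
  subst h
  rfl

/-- Restriction of sections, as a linear map into the fibred product. -/
noncomputable def restrictₗ : Cₛ^∞⟮𝓡 d; F, E⟯ →ₗ[ℝ] D.fibredProduct F E where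
  toFun s := ⟨D.restrict F E s, fun i j x =>
    TotalSpace.mk_inj.2 (D.cast_section E s (D.φ_f i j x))⟩
  map_add' _ _ := rfl
  map_smul' _ _ := rfl

theorem restrictₗ_injective : Function.Injective (D.restrictₗ F E) := by
  intro s t h
  ext p
  obtain ⟨⟨i, x⟩, rfl⟩ := D.exists_rep p
  exact congrArg (fun r : D.fibredProduct F E => r.1 i x) h

variable {F E} in
/-- Compatible sections have the same value at two representatives of the same point. -/
theorem cast_fibredProduct (s : D.fibredProduct F E) {i j : I} {x : M i} {y : M j}
    (h : D.incl i x = D.incl j y) :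
    LinearEquiv.cast (R := ℝ) (M := E) h (s.1 i x) = s.1 j y := by
  obtain ⟨hx, rfl⟩ := D.incl_eq_incl.1 h
  have h' : D.fibreEquiv E i j ⟨x, hx⟩ (s.1 i x) = s.1 j (D.f i j ⟨x, hx⟩) :=
    TotalSpace.mk_inj.1 (s.2 i j ⟨x, hx⟩)
  -- `fibreEquiv` casts along another proof of the same equality of points; proof irrelevance
  -- identifies the two casts.
  exact h'

variable {F E} in
/-- The (set-theoretic) section of `E` glued from compatible sections of the `E_i`. -/
noncomputable def glue (s : D.fibredProduct F E) (p : D.Space) : E p :=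
  LinearEquiv.cast (R := ℝ) (M := E) (D.exists_rep p).choose_spec
    (s.1 (D.exists_rep p).choose.1 (D.exists_rep p).choose.2)

/-- The representative of `φ i x` chosen in `glue` need not be `(i, x)`; compatibility makes the
choice immaterial. -/
theorem glue_incl (s : D.fibredProduct F E) (i : I) (x : M i) :
    D.glue s (D.φ i x) = s.1 i x :=
  D.cast_fibredProduct s (D.exists_rep (D.φ i x)).choose_spec

theorem restrictₗ_surjective : Function.Surjective (D.restrictₗ F E) := by
  intro s
  refine ⟨⟨D.glue s, fun p => ?_⟩, ?_⟩
  -- Smoothness at any point can be checked in one `M i` through which it is represented, where the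
  -- glued section is `s.1 i`.
  · obtain ⟨⟨i, x⟩, rfl⟩ := D.exists_rep p
    refine (D.contMDiffAt_section_incl_iff F E (D.glue s) i x).2 ?_
    refine ((s.1 i).contMDiff x).congr_of_eventuallyEq (.of_forall fun y => ?_)
    exact TotalSpace.mk_inj.2 (D.glue_incl F E s i y)
  · refine Subtype.ext (funext fun i => ?_)
    ext x
    exact D.glue_incl F E s i x

end

end SmoothAdjunctionSystem

theorem mainTheorem5 {d : ℕ} {I : Type*} [Finite I] {M : I → Type*}
    [∀ i, TopologicalSpace (M i)] [∀ i, T2Space (M i)] [∀ i, SecondCountableTopology (M i)]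
    [∀ i, ChartedSpace (EuclideanSpace ℝ (Fin d)) (M i)] [∀ i, IsManifold (𝓡 d) ∞ (M i)]
    (D : SmoothAdjunctionSystem d M)
    (F : Type*) [NormedAddCommGroup F] [NormedSpace ℝ F] [FiniteDimensional ℝ F]
    (E : D.Space → Type*) [TopologicalSpace (TotalSpace F E)]
    [∀ p, AddCommGroup (E p)] [∀ p, Module ℝ (E p)] [∀ p, TopologicalSpace (E p)]
    [FiberBundle F E] [VectorBundle ℝ F E] [ContMDiffVectorBundle ∞ F E (𝓡 d)] :
    ∃ Φ : Cₛ^∞⟮𝓡 d; F, E⟯ ≃ₗ[ℝ] D.fibredProduct F E,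
      ∀ (s : Cₛ^∞⟮𝓡 d; F, E⟯) (i : I) (x : M i), (Φ s).1 i x = s (D.φ i x) :=
  ⟨.ofBijective (D.restrictₗ F E) ⟨D.restrictₗ_injective F E, D.restrictₗ_surjective F E⟩,
    fun _ _ _ => rfl⟩
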